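/- Let $k$ be a field of characteristic zero and let $r\geq 3$ be an integer. Then there is a finite set $X$ of ($k$-rational) points of $\mathbf P^r$, not contained in a hyperplane, with the following properties. Let $R=k[x_0,\dots,x_r]$ and let $I_X\subset R$ be the homogeneous ideal generated by all forms vanishing at every point of $X$. By an artinian reduction of $R/I_X$ we mean an artinian quotient $A=R/(I_X,\ell)$, where $\ell$ is a linear form that is a nonzerodivisor on $R/I_X$. Its $h$-vector is $(h_0,\dots,h_e)$, where $h_i=\dim_k A_i$ and $e$ is the largest index with $A_e\neq 0$. (1) $X$ is level: artinian reductions of $R/I_X$ exist, and there is an integer $t$ such that every artinian reduction $A$ is level of type $t$, i.e. its socle $\{a\in A\mid a\,\overline{x_0}=\dots=a\,\overline{x_r}=0\}$ has dimension $t$ in degree $e$ and is zero in all other degrees. (2) The $h$-vector of every artinian reduction of $R/I_X$ is non-unimodal, i.e. there is no index $m$ such that $h_0\leq h_1\leq\dots\leq h_m\geq h_{m+1}\geq\dots\geq h_e$. -/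

import Mathlib

noncomputable section

namespace LevelPoints

open MvPolynomial

variable {k : Type*} [Field k] {σ : Type*}

/-- The degree `i` piece `A_i` of `A = k[x_j : j ∈ σ] / J` (for `J` a homogeneous ideal):
the classes of the forms of degree `i`. -/
def gradedPiece (J : Ideal (MvPolynomial σ k)) (i : ℕ) : Submodule k (MvPolynomial σ k ⧸ J) :=
  (homogeneousSubmodule σ k i).map (Ideal.Quotient.mkₐ k J).toLinearMap

/-- The entries `h_i = dim_k A_i` of the `h`-vector of a graded artinian algebra `A = R / J`,
extended by zero beyond the last nonzero entry. -/
def hVector (J : Ideal (MvPolynomial σ k)) (i : ℕ) : ℕ :=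
  Module.finrank k (gradedPiece J i)

/-- The socle of `A = R / J`: the annihilator of the ideal generated by the classes of the
variables. -/
def socle (J : Ideal (MvPolynomial σ k)) : Submodule k (MvPolynomial σ k ⧸ J) where
  carrier := {a | ∀ j : σ, a * Ideal.Quotient.mk J (X j) = 0}
  add_mem' := fun ha hb j => by rw [add_mul, ha j, hb j, add_zero]
  zero_mem' := fun j => zero_mul _
  smul_mem' := fun c a ha j => by rw [smul_mul_assoc, ha j, smul_zero]

/-- The entries `s_i = dim_k soc(A)_i` of the socle-vector of `A = R / J`. -/
def socleVector (J : Ideal (MvPolynomial σ k)) (i : ℕ) : ℕ :=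
  Module.finrank k (socle J ⊓ gradedPiece J i : Submodule k (MvPolynomial σ k ⧸ J))

/-- The graded artinian algebra `R / J` is level of type `t`: if `e` is the last degree in which
it is nonzero, its socle-vector is `(0, …, 0, s_e = t)`. -/
def IsLevelOfType (J : Ideal (MvPolynomial σ k)) (t : ℕ) : Prop :=
  ∃ e : ℕ, gradedPiece J e ≠ ⊥ ∧ (∀ i, e < i → gradedPiece J i = ⊥) ∧
    socleVector J e = t ∧ ∀ i, i ≠ e → socleVector J i = 0

/-- `h_0 ≤ … ≤ h_m ≥ h_{m+1} ≥ …` for some `m`. (For a finite vector with nonnegative entries and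
positive last entry, extending it by zero does not affect this.) -/
def IsUnimodal (h : ℕ → ℕ) : Prop :=
  ∃ m : ℕ, MonotoneOn h (Set.Iic m) ∧ AntitoneOn h (Set.Ici m)

/-- `R / J` is an artinian reduction of the one-dimensional standard graded algebra `R / I`: its
artinian quotient by a linear form that is a nonzerodivisor on `R / I`. -/
def IsArtinianReduction (I J : Ideal (MvPolynomial σ k)) : Prop :=
  ∃ l : MvPolynomial σ k, l.IsHomogeneous 1 ∧
    Ideal.Quotient.mk I l ∈ nonZeroDivisors (MvPolynomial σ k ⧸ I) ∧
    J = I ⊔ Ideal.span {l} ∧ IsArtinianRing (MvPolynomial σ k ⧸ J)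

/-- The homogeneous ideal of a set of points of `𝐏^r`, generated by the forms that vanish at all
of the points. -/
def pointsIdeal {r : ℕ} (X : Set (Projectivization k (Fin (r + 1) → k))) :
    Ideal (MvPolynomial (Fin (r + 1)) k) :=
  Ideal.span {f | (∃ d : ℕ, f.IsHomogeneous d) ∧ ∀ P ∈ X, eval P.rep f = 0}

/-- `X` is not contained in a hyperplane: its ideal contains no nonzero linear form. -/
def IsNondegenerate {r : ℕ} (X : Set (Projectivization k (Fin (r + 1) → k))) : Prop :=
  ∀ f ∈ pointsIdeal X, f.IsHomogeneous 1 → f = 0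

/-- `X` is a level set of points: for some `t`, all the artinian reductions of its homogeneous
coordinate ring (and there are some) are level of type `t`. -/
def IsLevelSet {r : ℕ} (X : Set (Projectivization k (Fin (r + 1) → k))) : Prop :=
  (∃ J, IsArtinianReduction (pointsIdeal X) J) ∧
    ∃ t : ℕ, ∀ J, IsArtinianReduction (pointsIdeal X) J → IsLevelOfType J t

end LevelPoints

end

noncomputable section

namespace LevelPoints

open MvPolynomial

variable {k : Type*} [Field k] {σ : Type*}

/-! ### Monomial quotients and their standard monomials -/

section MonomialQuotient

variable {J : Ideal (MvPolynomial σ k)} {D : Set (σ →₀ ℕ)}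

/-! Read the exponent vectors of a finite order ideal `D` of monomials in x_1, …, x_r as points (1 :
m_1 : … : m_r). Cutting by x_0 = 0 degenerates their ideal to the monomial ideal with standard
monomials `D` (`mem_pointsIdeal_sup_span_X_zero_iff`). Indeed, for x^m free of x_0 and outside `D`,
`newtonForm` lifts x^m to a form vanishing at all the points. Conversely, finite differences over
the box below m ∈ `D` recover, in characteristic zero, the x^m-coefficient of a form of degree |m|
from its values at the points. So the h-vector counts `D` by degree, and the reduction is level when
`D` is pure.

Every other reduction has the same h-vector and socle-vector: for regular linear forms l, l', the
lifts S, S' of the socles to R/I satisfy l'S = lS' (`map_mulLeft_socleLift_le` in both directions).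

It remains to find a pure `D` with a dip. In `pureOrderIdeal` the slab of x_1-degree below 3 has 3i
monomials in degree i (2 ≤ i ≤ 12). The rest of the box under x_1^6 x_2^3 x_3^3 adds 10, 6, 3, 1 in
degrees 9 to 12, giving 37, 36, 36, 37. Each extra variable adds 1 in every positive degree. -/

lemma mem_gradedPiece {J : Ideal (MvPolynomial σ k)} {i : ℕ} {a : MvPolynomial σ k ⧸ J} :
    a ∈ gradedPiece J i ↔ ∃ f : MvPolynomial σ k, f.IsHomogeneous i ∧ Ideal.Quotient.mk J f = a :=
  Iff.rfl

/-- The hypothesis `hJ` makes `J` the span of the monomials outside `D`; as `J` is an ideal, this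
forces `D` to be closed under divisors. -/
lemma gradedPiece_eq_span_of_mem_iff (hJ : ∀ f, f ∈ J ↔ ∀ m ∈ D, coeff m f = 0) (i : ℕ) :
    gradedPiece J i = Submodule.span k
      (Set.range fun m : {m : σ →₀ ℕ | m ∈ D ∧ m.degree = i} =>
        Ideal.Quotient.mk J (monomial m.1 1)) := by
  apply le_antisymm
  · rintro _ ⟨f, hf, rfl⟩
    have hf : f.IsHomogeneous i := hf
    rw [f.as_sum, map_sum]
    refine Submodule.sum_mem _ fun m hm => ?_
    have hdeg : m.degree = i := by
      by_contra h
      exact (mem_support_iff.mp hm) (hf.coeff_eq_zero h)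
    have h1 : (Ideal.Quotient.mkₐ k J).toLinearMap (monomial m (coeff m f)) =
        coeff m f • Ideal.Quotient.mk J (monomial m 1) := by
      rw [← mul_one (coeff m f), ← smul_eq_mul, ← smul_monomial, map_smul]
      simp
    rw [h1]
    refine Submodule.smul_mem _ _ ?_
    by_cases hD : m ∈ D
    · exact Submodule.subset_span ⟨⟨m, hD, hdeg⟩, rfl⟩
    · have : (monomial m (1 : k)) ∈ J := by
        classical
        rw [hJ]
        intro n hn
        rw [coeff_monomial, if_neg]
        rintro rfl
        exact hD hn
      rw [Ideal.Quotient.eq_zero_iff_mem.mpr this]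
      exact zero_mem _
  · rw [Submodule.span_le]
    rintro _ ⟨⟨m, hm, hdeg⟩, rfl⟩
    exact ⟨monomial m 1, isHomogeneous_monomial _ hdeg, rfl⟩

lemma linearIndependent_monomial_of_mem_iff (hJ : ∀ f, f ∈ J ↔ ∀ m ∈ D, coeff m f = 0) :
    LinearIndependent k fun m : D => Ideal.Quotient.mk J (monomial m.1 (1 : k)) := by
  rw [linearIndependent_iff']
  intro s g hg m hm
  have h1 : Ideal.Quotient.mk J (∑ n ∈ s, monomial n.1 (g n)) = 0 := by
    rw [map_sum, ← hg]
    refine Finset.sum_congr rfl fun n _ => ?_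
    have h1 : (Ideal.Quotient.mkₐ k J) (monomial n.1 (g n)) =
        g n • (Ideal.Quotient.mkₐ k J) (monomial n.1 1) := by
      rw [← map_smul, smul_monomial, smul_eq_mul, mul_one]
    exact h1
  rw [Ideal.Quotient.eq_zero_iff_mem, hJ] at h1
  have h2 := h1 m m.2
  classical
  rw [coeff_sum, Finset.sum_eq_single m] at h2
  · simpa using h2
  · intro n _ hn
    rw [coeff_monomial, if_neg fun h => hn (Subtype.ext h)]
  · exact fun h => (h hm).elim

lemma hVector_eq_ncard_of_mem_iff (hD : D.Finite)
    (hJ : ∀ f, f ∈ J ↔ ∀ m ∈ D, coeff m f = 0) (i : ℕ) :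
    hVector J i = {m : σ →₀ ℕ | m ∈ D ∧ m.degree = i}.ncard := by
  have hfin : {m : σ →₀ ℕ | m ∈ D ∧ m.degree = i}.Finite := hD.subset fun m hm => hm.1
  have := hfin.fintype
  rw [hVector, gradedPiece_eq_span_of_mem_iff hJ, finrank_span_eq_card, ← Nat.card_eq_fintype_card,
    Nat.card_coe_set_eq]
  exact (linearIndependent_monomial_of_mem_iff hJ).comp
    (fun m : {m : σ →₀ ℕ | m ∈ D ∧ m.degree = i} => (⟨m.1, m.2.1⟩ : D))
    fun a b h => Subtype.ext (congrArg (fun x : D => x.1) h)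

lemma module_finite_of_mem_iff (hD : D.Finite)
    (hJ : ∀ f, f ∈ J ↔ ∀ m ∈ D, coeff m f = 0) : Module.Finite k (MvPolynomial σ k ⧸ J) := by
  refine ⟨Submodule.fg_def.mpr
    ⟨(fun m => Ideal.Quotient.mk J (monomial m (1 : k))) '' D, hD.image _, ?_⟩⟩
  rw [eq_top_iff]
  rintro a -
  obtain ⟨f, rfl⟩ := Ideal.Quotient.mk_surjective a
  rw [← sum_homogeneousComponent f, map_sum]
  refine Submodule.sum_mem _ fun i _ => ?_
  have h : Ideal.Quotient.mk J (homogeneousComponent i f) ∈ gradedPiece J i :=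
    mem_gradedPiece.mpr ⟨_, homogeneousComponent_isHomogeneous i f, rfl⟩
  rw [gradedPiece_eq_span_of_mem_iff hJ] at h
  refine Submodule.span_mono ?_ h
  rintro _ ⟨m, rfl⟩
  exact ⟨m.1, m.2.1, rfl⟩

/-- A monomial algebra whose standard monomials form a pure order ideal is level. -/
lemma socle_inf_gradedPiece_eq_bot (hJ : ∀ f, f ∈ J ↔ ∀ m ∈ D, coeff m f = 0) {i : ℕ}
    (hpure : ∀ m ∈ D, m.degree = i → ∃ j, m + Finsupp.single j 1 ∈ D) :
    socle J ⊓ gradedPiece J i = ⊥ := by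
  rw [eq_bot_iff]
  rintro a ⟨ha, hi⟩
  obtain ⟨f, hf, rfl⟩ := mem_gradedPiece.mp hi
  rw [Submodule.mem_bot, Ideal.Quotient.eq_zero_iff_mem, hJ]
  intro m hm
  by_cases hdeg : m.degree = i
  · obtain ⟨j, hj⟩ := hpure m hm hdeg
    have h : Ideal.Quotient.mk J f * Ideal.Quotient.mk J (X j) = 0 := ha j
    rw [← map_mul, Ideal.Quotient.eq_zero_iff_mem, hJ] at h
    -- The coefficient of f·x_j at m + e_j is that of f at m.
    simpa [coeff_mul_X] using h _ hj
  · exact hf.coeff_eq_zero hdeg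

end MonomialQuotient

/-! ### Independence of the artinian reduction -/

section ArtinianReduction

variable {I : Ideal (MvPolynomial σ k)}

lemma finite_gradedPiece [Finite σ] (J : Ideal (MvPolynomial σ k)) (i : ℕ) :
    Module.Finite k (gradedPiece J i) :=
  Module.Finite.iff_fg.mpr ((homogeneousSubmodule_fg (σ := σ) (R := k) i).map _)

/-- The elements `s` of degree `i` in `R / I` with `x_j s ∈ (l)` for all `j`. -/
def socleLift (I : Ideal (MvPolynomial σ k)) (l : MvPolynomial σ k) (i : ℕ) :
    Submodule k (MvPolynomial σ k ⧸ I) where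
  carrier := {s | s ∈ gradedPiece I i ∧ ∀ j : σ, Ideal.Quotient.mk I l ∣ s * Ideal.Quotient.mk I (X j)}
  add_mem' := fun ha hb => ⟨add_mem ha.1 hb.1, fun j => by
    rw [add_mul]; exact dvd_add (ha.2 j) (hb.2 j)⟩
  zero_mem' := ⟨zero_mem _, fun j => by rw [zero_mul]; exact dvd_zero _⟩
  smul_mem' := fun c a ha => ⟨Submodule.smul_mem _ c ha.1, fun j => by
    rw [smul_mul_assoc]; exact dvd_smul_of_dvd c (ha.2 j)⟩

/-- The multiples of `l` of degree `i` in `R / I`. -/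
def mulPiece (I : Ideal (MvPolynomial σ k)) (l : MvPolynomial σ k) (i : ℕ) :
    Submodule k (MvPolynomial σ k ⧸ I) where
  carrier := {s | s ∈ gradedPiece I i ∧ Ideal.Quotient.mk I l ∣ s}
  add_mem' := fun ha hb => ⟨add_mem ha.1 hb.1, dvd_add ha.2 hb.2⟩
  zero_mem' := ⟨zero_mem _, dvd_zero _⟩
  smul_mem' := fun c _ ha => ⟨Submodule.smul_mem _ c ha.1, dvd_smul_of_dvd c ha.2⟩

lemma homogeneousComponent_mul_of_isHomogeneous {l : MvPolynomial σ k} (hl : l.IsHomogeneous 1)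
    (f : MvPolynomial σ k) (i : ℕ) :
    homogeneousComponent (i + 1) (l * f) = l * homogeneousComponent i f := by
  conv_lhs => rw [← sum_homogeneousComponent f, Finset.mul_sum, map_sum]
  have h : ∀ d, homogeneousComponent (i + 1) (l * homogeneousComponent d f) =
      if d = i then l * homogeneousComponent i f else 0 := by
    intro d
    have h1 : l * homogeneousComponent d f ∈ homogeneousSubmodule σ k (1 + d) :=
      hl.mul (homogeneousComponent_isHomogeneous d f)
    rw [homogeneousComponent_of_mem h1]
    by_cases hd : d = i
    · subst hd; rw [if_pos (add_comm _ _), if_pos rfl]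
    · rw [if_neg (by omega), if_neg hd]
  simp_rw [h]
  rw [Finset.sum_ite_eq']
  split_ifs with hi
  · rfl
  · rw [homogeneousComponent_eq_zero, mul_zero]
    simpa using hi

lemma homogeneousComponent_zero_mul_of_isHomogeneous {l : MvPolynomial σ k}
    (hl : l.IsHomogeneous 1) (f : MvPolynomial σ k) : homogeneousComponent 0 (l * f) = 0 := by
  have h : coeff 0 l = 0 := hl.coeff_eq_zero (by simp)
  simp [homogeneousComponent_zero, ← constantCoeff_eq] at h ⊢
  exact Or.inl h

/-- Since `I` is homogeneous, any cofactor may be replaced by its degree `i` component. -/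
lemma exists_mem_gradedPiece_of_dvd (hI : ∀ f ∈ I, ∀ i, homogeneousComponent i f ∈ I)
    {l : MvPolynomial σ k} (hl : l.IsHomogeneous 1) {i : ℕ}
    {s : MvPolynomial σ k ⧸ I} (hs : s ∈ gradedPiece I (i + 1)) (h : Ideal.Quotient.mk I l ∣ s) :
    ∃ t ∈ gradedPiece I i, s = Ideal.Quotient.mk I l * t := by
  obtain ⟨f, hf, rfl⟩ := mem_gradedPiece.mp hs
  obtain ⟨u, hu⟩ := h
  obtain ⟨g, rfl⟩ := Ideal.Quotient.mk_surjective u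
  refine ⟨_, mem_gradedPiece.mpr ⟨_, homogeneousComponent_isHomogeneous i g, rfl⟩, ?_⟩
  rw [← map_mul, Ideal.Quotient.eq] at hu ⊢
  have := hI _ hu (i + 1)
  rwa [map_sub, homogeneousComponent_mul_of_isHomogeneous hl, homogeneousComponent_eq_self hf]
    at this

lemma mulPiece_zero (hI : ∀ f ∈ I, ∀ i, homogeneousComponent i f ∈ I)
    {l : MvPolynomial σ k} (hl : l.IsHomogeneous 1) : mulPiece I l 0 = ⊥ := by
  rw [eq_bot_iff]
  rintro s ⟨hs, h⟩
  obtain ⟨f, hf, rfl⟩ := mem_gradedPiece.mp hs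
  obtain ⟨u, hu⟩ := h
  obtain ⟨g, rfl⟩ := Ideal.Quotient.mk_surjective u
  rw [← map_mul, Ideal.Quotient.eq] at hu
  have := hI _ hu 0
  rw [map_sub, homogeneousComponent_zero_mul_of_isHomogeneous hl, homogeneousComponent_eq_self hf,
    sub_zero] at this
  exact Ideal.Quotient.eq_zero_iff_mem.mpr this

lemma mul_mem_gradedPiece {i j : ℕ} {s t : MvPolynomial σ k ⧸ I} (hs : s ∈ gradedPiece I i)
    (ht : t ∈ gradedPiece I j) : s * t ∈ gradedPiece I (i + j) := by
  obtain ⟨f, hf, rfl⟩ := mem_gradedPiece.mp hs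
  obtain ⟨g, hg, rfl⟩ := mem_gradedPiece.mp ht
  exact mem_gradedPiece.mpr ⟨f * g, hf.mul hg, map_mul _ _ _⟩

lemma finrank_mulPiece_succ (hI : ∀ f ∈ I, ∀ i, homogeneousComponent i f ∈ I)
    {l : MvPolynomial σ k} (hl : l.IsHomogeneous 1)
    (hreg : Ideal.Quotient.mk I l ∈ nonZeroDivisors (MvPolynomial σ k ⧸ I)) (i : ℕ) :
    Module.finrank k (mulPiece I l (i + 1)) = Module.finrank k (gradedPiece I i) := by
  have hinj : Function.Injective (LinearMap.mulLeft k (Ideal.Quotient.mk I l)) :=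
    fun a b h => mul_cancel_left_mem_nonZeroDivisors hreg |>.mp h
  have h : mulPiece I l (i + 1) =
      (gradedPiece I i).map (LinearMap.mulLeft k (Ideal.Quotient.mk I l)) := by
    ext s
    constructor
    · rintro ⟨hs, h⟩
      obtain ⟨t, ht, rfl⟩ := exists_mem_gradedPiece_of_dvd hI hl hs h
      exact ⟨t, ht, rfl⟩
    · rintro ⟨t, ht, rfl⟩
      refine ⟨?_, _, rfl⟩
      rw [add_comm]
      exact mul_mem_gradedPiece (mem_gradedPiece.mpr ⟨l, hl, rfl⟩) ht
  rw [h, (Submodule.equivMapOfInjective _ hinj (gradedPiece I i)).finrank_eq]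

lemma finrank_mulPiece_eq (hI : ∀ f ∈ I, ∀ i, homogeneousComponent i f ∈ I)
    {l l' : MvPolynomial σ k} (hl : l.IsHomogeneous 1) (hl' : l'.IsHomogeneous 1)
    (hreg : Ideal.Quotient.mk I l ∈ nonZeroDivisors (MvPolynomial σ k ⧸ I))
    (hreg' : Ideal.Quotient.mk I l' ∈ nonZeroDivisors (MvPolynomial σ k ⧸ I)) (i : ℕ) :
    Module.finrank k (mulPiece I l i) = Module.finrank k (mulPiece I l' i) := by
  cases i with
  | zero => rw [mulPiece_zero hI hl, mulPiece_zero hI hl']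
  | succ i => rw [finrank_mulPiece_succ hI hl hreg, finrank_mulPiece_succ hI hl' hreg']

/-- A linear form is a combination of the variables, each of which multiplies s into (l). -/
lemma mk_dvd_mul_of_mem_socleLift {l l' : MvPolynomial σ k} (hl' : l'.IsHomogeneous 1) {i : ℕ}
    {s : MvPolynomial σ k ⧸ I} (hs : s ∈ socleLift I l i) :
    Ideal.Quotient.mk I l ∣ Ideal.Quotient.mk I l' * s := by
  have h : l' ∈ Submodule.span k (Set.range (X : σ → MvPolynomial σ k)) := by
    rw [← homogeneousSubmodule_one_eq_span_X]; exact hl'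
  clear hl'
  induction h using Submodule.span_induction with
  | mem x hx => obtain ⟨j, rfl⟩ := hx; rw [mul_comm]; exact hs.2 j
  | zero => simp
  | add x y _ _ hx hy => rw [map_add, add_mul]; exact dvd_add hx hy
  | smul c x _ hx =>
    have : Ideal.Quotient.mk I (c • x) = c • Ideal.Quotient.mk I x := rfl
    rw [this, smul_mul_assoc]
    exact dvd_smul_of_dvd c hx

/-- Write l's = lt and x_j s = lu. Then l·(t x_j) = l's x_j = l·(l'u), and cancelling l shows that
l' divides t x_j. -/
lemma map_mulLeft_socleLift_le (hI : ∀ f ∈ I, ∀ i, homogeneousComponent i f ∈ I)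
    {l l' : MvPolynomial σ k} (hl : l.IsHomogeneous 1) (hl' : l'.IsHomogeneous 1)
    (hreg : Ideal.Quotient.mk I l ∈ nonZeroDivisors (MvPolynomial σ k ⧸ I)) (i : ℕ) :
    (socleLift I l i).map (LinearMap.mulLeft k (Ideal.Quotient.mk I l')) ≤
      (socleLift I l' i).map (LinearMap.mulLeft k (Ideal.Quotient.mk I l)) := by
  rintro _ ⟨s, hs, rfl⟩
  have h1 : Ideal.Quotient.mk I l' * s ∈ gradedPiece I (i + 1) := by
    rw [add_comm]
    exact mul_mem_gradedPiece (mem_gradedPiece.mpr ⟨l', hl', rfl⟩) hs.1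
  obtain ⟨t, ht, hst⟩ := exists_mem_gradedPiece_of_dvd hI hl h1 (mk_dvd_mul_of_mem_socleLift hl' hs)
  refine ⟨t, ⟨ht, fun j => ?_⟩, hst.symm⟩
  obtain ⟨u, hu⟩ := hs.2 j
  refine ⟨u, (mul_cancel_left_mem_nonZeroDivisors hreg).mp ?_⟩
  rw [← mul_assoc, ← hst, mul_assoc, hu]
  ring

/-- The two inclusions make the images under l' and l equal, and both multiplications are injective.
-/
lemma finrank_socleLift_eq (hI : ∀ f ∈ I, ∀ i, homogeneousComponent i f ∈ I)
    {l l' : MvPolynomial σ k} (hl : l.IsHomogeneous 1) (hl' : l'.IsHomogeneous 1)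
    (hreg : Ideal.Quotient.mk I l ∈ nonZeroDivisors (MvPolynomial σ k ⧸ I))
    (hreg' : Ideal.Quotient.mk I l' ∈ nonZeroDivisors (MvPolynomial σ k ⧸ I)) (i : ℕ) :
    Module.finrank k (socleLift I l i) = Module.finrank k (socleLift I l' i) := by
  have hinj : Function.Injective (LinearMap.mulLeft k (Ideal.Quotient.mk I l)) :=
    fun a b h => mul_cancel_left_mem_nonZeroDivisors hreg |>.mp h
  have hinj' : Function.Injective (LinearMap.mulLeft k (Ideal.Quotient.mk I l')) :=
    fun a b h => mul_cancel_left_mem_nonZeroDivisors hreg' |>.mp h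
  rw [(Submodule.equivMapOfInjective _ hinj' (socleLift I l i)).finrank_eq,
    (Submodule.equivMapOfInjective _ hinj (socleLift I l' i)).finrank_eq,
    le_antisymm (map_mulLeft_socleLift_le hI hl hl' hreg i)
      (map_mulLeft_socleLift_le hI hl' hl hreg' i)]

lemma finrank_map_add_finrank_inf_ker {V W : Type*} [AddCommGroup V] [Module k V]
    [AddCommGroup W] [Module k W] (f : V →ₗ[k] W) (p : Submodule k V) [Module.Finite k p] :
    Module.finrank k (p.map f) + Module.finrank k (p ⊓ LinearMap.ker f : Submodule k V) =
      Module.finrank k p := by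
  have h := LinearMap.finrank_range_add_finrank_ker (f.domRestrict p)
  rw [LinearMap.range_domRestrict, LinearMap.ker_domRestrict] at h
  rw [← h, ← Submodule.map_comap_subtype p (LinearMap.ker f),
    ← (Submodule.equivMapOfInjective p.subtype p.injective_subtype _).finrank_eq]

/-- The projection from `R / I` to `R / (I, l)`. -/
def quotientSup (I : Ideal (MvPolynomial σ k)) (l : MvPolynomial σ k) :
    (MvPolynomial σ k ⧸ I) →ₗ[k] MvPolynomial σ k ⧸ (I ⊔ Ideal.span {l}) :=
  (Ideal.Quotient.factorₐ k (le_sup_left : I ≤ I ⊔ Ideal.span {l})).toLinearMap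

lemma quotientSup_mk (l f : MvPolynomial σ k) :
    quotientSup I l (Ideal.Quotient.mk I f) = Ideal.Quotient.mk (I ⊔ Ideal.span {l}) f := rfl

lemma quotientSup_eq_zero_iff {l : MvPolynomial σ k} {s : MvPolynomial σ k ⧸ I} :
    quotientSup I l s = 0 ↔ Ideal.Quotient.mk I l ∣ s := by
  obtain ⟨f, rfl⟩ := Ideal.Quotient.mk_surjective s
  rw [quotientSup_mk, Ideal.Quotient.eq_zero_iff_mem, Submodule.mem_sup]
  constructor
  · rintro ⟨g, hg, h, hh, rfl⟩
    obtain ⟨u, rfl⟩ := Ideal.mem_span_singleton.mp hh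
    rw [map_add, Ideal.Quotient.eq_zero_iff_mem.mpr hg, zero_add, map_mul]
    exact dvd_mul_right _ _
  · rintro ⟨u, hu⟩
    obtain ⟨g, rfl⟩ := Ideal.Quotient.mk_surjective u
    rw [← map_mul, Ideal.Quotient.eq] at hu
    exact ⟨_, hu, l * g, Ideal.mem_span_singleton.mpr (dvd_mul_right _ _), by ring⟩

lemma map_quotientSup_gradedPiece (l : MvPolynomial σ k) (i : ℕ) :
    (gradedPiece I i).map (quotientSup I l) = gradedPiece (I ⊔ Ideal.span {l}) i := by
  rw [gradedPiece, ← Submodule.map_comp]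
  rfl

lemma map_quotientSup_socleLift (l : MvPolynomial σ k) (i : ℕ) :
    (socleLift I l i).map (quotientSup I l) =
      socle (I ⊔ Ideal.span {l}) ⊓ gradedPiece (I ⊔ Ideal.span {l}) i := by
  have key : ∀ s : MvPolynomial σ k ⧸ I, (∀ j, Ideal.Quotient.mk I l ∣ s * Ideal.Quotient.mk I (X j))
      ↔ quotientSup I l s ∈ socle (I ⊔ Ideal.span {l}) := by
    intro s
    obtain ⟨f, rfl⟩ := Ideal.Quotient.mk_surjective s
    refine forall_congr' fun j => ?_
    rw [← quotientSup_eq_zero_iff, ← map_mul, quotientSup_mk, quotientSup_mk, map_mul]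
  ext a
  rw [← map_quotientSup_gradedPiece]
  constructor
  · rintro ⟨s, hs, rfl⟩
    exact ⟨(key s).mp hs.2, s, hs.1, rfl⟩
  · rintro ⟨ha, s, hs, rfl⟩
    exact ⟨s, ⟨hs, (key s).mpr ha⟩, rfl⟩

lemma hVector_add_finrank_mulPiece [Finite σ] (l : MvPolynomial σ k) (i : ℕ) :
    hVector (I ⊔ Ideal.span {l}) i + Module.finrank k (mulPiece I l i) =
      Module.finrank k (gradedPiece I i) := by
  have := finite_gradedPiece I i
  have h : mulPiece I l i = gradedPiece I i ⊓ LinearMap.ker (quotientSup I l) := by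
    ext s
    exact and_congr_right fun _ => quotientSup_eq_zero_iff.symm
  rw [hVector, ← finrank_map_add_finrank_inf_ker (quotientSup I l) (gradedPiece I i),
    map_quotientSup_gradedPiece, h]

lemma socleVector_add_finrank_mulPiece [Finite σ] (l : MvPolynomial σ k) (i : ℕ) :
    socleVector (I ⊔ Ideal.span {l}) i + Module.finrank k (mulPiece I l i) =
      Module.finrank k (socleLift I l i) := by
  have := finite_gradedPiece I i
  have hle : socleLift I l i ≤ gradedPiece I i := fun s hs => hs.1
  have : Module.Finite k (socleLift I l i) := Submodule.finiteDimensional_of_le hle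
  have h : mulPiece I l i = socleLift I l i ⊓ LinearMap.ker (quotientSup I l) := by
    ext s
    constructor
    · exact fun h => ⟨⟨h.1, fun j => h.2.mul_right _⟩, quotientSup_eq_zero_iff.mpr h.2⟩
    · exact fun h => ⟨h.1.1, quotientSup_eq_zero_iff.mp h.2⟩
  rw [socleVector, ← finrank_map_add_finrank_inf_ker (quotientSup I l) (socleLift I l i),
    map_quotientSup_socleLift, h]

/-- The `h`-vector does not depend on the choice of the artinian reduction. -/
lemma hVector_eq_of_isArtinianReduction [Finite σ]
    (hI : ∀ f ∈ I, ∀ i, homogeneousComponent i f ∈ I) {J J' : Ideal (MvPolynomial σ k)}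
    (hJ : IsArtinianReduction I J) (hJ' : IsArtinianReduction I J') :
    hVector J = hVector J' := by
  obtain ⟨l, hl, hreg, rfl, -⟩ := hJ
  obtain ⟨l', hl', hreg', rfl, -⟩ := hJ'
  funext i
  have h := hVector_add_finrank_mulPiece (I := I) l i
  rw [finrank_mulPiece_eq hI hl hl' hreg hreg',
    ← hVector_add_finrank_mulPiece (I := I) l' i] at h
  exact Nat.add_right_cancel h

/-- The socle-vector does not depend on the choice of the artinian reduction. -/
lemma socleVector_eq_of_isArtinianReduction [Finite σ]
    (hI : ∀ f ∈ I, ∀ i, homogeneousComponent i f ∈ I) {J J' : Ideal (MvPolynomial σ k)}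
    (hJ : IsArtinianReduction I J) (hJ' : IsArtinianReduction I J') :
    socleVector J = socleVector J' := by
  obtain ⟨l, hl, hreg, rfl, -⟩ := hJ
  obtain ⟨l', hl', hreg', rfl, -⟩ := hJ'
  funext i
  have h := socleVector_add_finrank_mulPiece (I := I) l i
  rw [finrank_mulPiece_eq hI hl hl' hreg hreg', finrank_socleLift_eq hI hl hl' hreg hreg',
    ← socleVector_add_finrank_mulPiece (I := I) l' i] at h
  exact Nat.add_right_cancel h

lemma hVector_eq_zero_iff [Finite σ] {J : Ideal (MvPolynomial σ k)} {i : ℕ} :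
    hVector J i = 0 ↔ gradedPiece J i = ⊥ := by
  have := finite_gradedPiece J i
  exact Submodule.finrank_eq_zero

lemma isLevelOfType_of_isArtinianReduction [Finite σ]
    (hI : ∀ f ∈ I, ∀ i, homogeneousComponent i f ∈ I) {J J' : Ideal (MvPolynomial σ k)}
    (hJ : IsArtinianReduction I J) (hJ' : IsArtinianReduction I J') {t : ℕ}
    (h : IsLevelOfType J t) : IsLevelOfType J' t := by
  obtain ⟨e, he⟩ := h
  refine ⟨e, ?_⟩
  simpa only [ne_eq, ← hVector_eq_zero_iff, hVector_eq_of_isArtinianReduction hI hJ hJ',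
    socleVector_eq_of_isArtinianReduction hI hJ hJ'] using he

end ArtinianReduction

/-! ### Ideals of lattice points of an order ideal -/

section PointsIdeal

variable {r : ℕ} {Y : Set (Projectivization k (Fin (r + 1) → k))}

lemma eval_rep_eq_zero_of_mem_pointsIdeal {f : MvPolynomial (Fin (r + 1)) k}
    (hf : f ∈ pointsIdeal Y) {P : Projectivization k (Fin (r + 1) → k)} (hP : P ∈ Y) :
    eval P.rep f = 0 := by
  have h : pointsIdeal Y ≤ RingHom.ker (eval P.rep) := Ideal.span_le.mpr fun g hg => hg.2 P hP
  exact h hf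

lemma homogeneousComponent_mem_pointsIdeal (f : MvPolynomial (Fin (r + 1)) k)
    (hf : f ∈ pointsIdeal Y) (i : ℕ) : homogeneousComponent i f ∈ pointsIdeal Y := by
  let _ := gradedAlgebra (σ := Fin (r + 1)) (R := k)
  refine homogeneousComponent_mem_of_mem
    (Ideal.homogeneous_span (homogeneousSubmodule (Fin (r + 1)) k) _ ?_) hf i
  rintro g ⟨⟨d, hd⟩, -⟩
  exact ⟨d, hd⟩

/-- The point `(1 : m_1 : … : m_r)`. -/
def latticePoint (k : Type*) [Field k] (m : Fin (r + 1) →₀ ℕ) :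
    Projectivization k (Fin (r + 1) → k) :=
  Projectivization.mk k (Function.update (fun i => (m i : k)) 0 1)
    fun h => one_ne_zero (α := k) (by simpa using congrFun h 0)

lemma eval_smul_of_isHomogeneous {f : MvPolynomial σ k} {d : ℕ} (hf : f.IsHomogeneous d)
    (c : k) (v : σ → k) : eval (c • v) f = c ^ d * eval v f := by
  simp only [eval_eq, Finset.mul_sum]
  refine Finset.sum_congr rfl fun m hm => ?_
  have h : m.degree = d := by
    by_contra h
    exact mem_support_iff.mp hm (hf.coeff_eq_zero h)
  simp only [Pi.smul_apply, smul_eq_mul, mul_pow, Finset.prod_mul_distrib, Finset.prod_pow_eq_pow_sum]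
  rw [← h, Finsupp.degree_apply]
  ring

/-- The chosen representative differs from (1, m_1, …, m_r) by a unit, which does not affect the
vanishing of a form. -/
lemma eval_rep_latticePoint_eq_zero_iff {f : MvPolynomial (Fin (r + 1)) k} {d : ℕ}
    (hf : f.IsHomogeneous d) (m : Fin (r + 1) →₀ ℕ) :
    eval (latticePoint k m).rep f = 0 ↔
      eval (Function.update (fun i => (m i : k)) 0 1) f = 0 := by
  obtain ⟨a, ha⟩ := Projectivization.exists_smul_eq_mk_rep k
    (Function.update (fun i => (m i : k)) 0 1)
    fun h => one_ne_zero (α := k) (by simpa using congrFun h 0)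
  rw [latticePoint, ← ha, Units.smul_def, eval_smul_of_isHomogeneous hf]
  simp

variable {D : Set (Fin (r + 1) →₀ ℕ)}

lemma mem_pointsIdeal_latticePoint_iff {f : MvPolynomial (Fin (r + 1)) k} {d : ℕ}
    (hf : f.IsHomogeneous d) : f ∈ pointsIdeal (latticePoint k '' D) ↔
      ∀ m ∈ D, eval (Function.update (fun i => (m i : k)) 0 1) f = 0 := by
  constructor
  · intro h m hm
    rw [← eval_rep_latticePoint_eq_zero_iff hf]
    exact eval_rep_eq_zero_of_mem_pointsIdeal h ⟨m, hm, rfl⟩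
  · intro h
    refine Ideal.subset_span ⟨⟨d, hf⟩, ?_⟩
    rintro _ ⟨m, hm, rfl⟩
    rw [eval_rep_latticePoint_eq_zero_iff hf]
    exact h m hm

/-- None of the points lies on x_0 = 0: this coordinate is 1, so x_0 f and f have the same values
there. Homogeneity reduces the claim to forms. -/
lemma X_zero_mem_nonZeroDivisors :
    Ideal.Quotient.mk (pointsIdeal (latticePoint k '' D)) (X 0) ∈
      nonZeroDivisors (MvPolynomial (Fin (r + 1)) k ⧸ pointsIdeal (latticePoint k '' D)) := by
  rw [mem_nonZeroDivisors_iff_left]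
  intro a ha
  obtain ⟨f, rfl⟩ := Ideal.Quotient.mk_surjective a
  rw [← map_mul, Ideal.Quotient.eq_zero_iff_mem] at ha
  rw [Ideal.Quotient.eq_zero_iff_mem, ← sum_homogeneousComponent f]
  refine sum_mem fun i _ => ?_
  have h := homogeneousComponent_mem_pointsIdeal _ ha (i + 1)
  rw [homogeneousComponent_mul_of_isHomogeneous (isHomogeneous_X k 0)] at h
  have hi := homogeneousComponent_isHomogeneous i f
  rw [mem_pointsIdeal_latticePoint_iff ((isHomogeneous_X k 0).mul hi)] at h
  rw [mem_pointsIdeal_latticePoint_iff hi]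
  intro m hm
  simpa using h m hm

/-- The sum is the n-th forward difference of x^c at 0, which kills degrees below n and sends x^n to
n!. -/
lemma sum_range_neg_one_pow_mul_choose_mul_pow (k : Type*) [Field k] (n c : ℕ) (hc : c ≤ n) :
    ∑ t ∈ Finset.range (n + 1), ((-1 : k) ^ (n - t) * (n.choose t : k)) * (t : k) ^ c =
      if c = n then (n.factorial : k) else 0 := by
  have h := fwdDiff_iter_eq_sum_shift (1 : k) (fun x : k => x ^ c) n 0
  simp only [zsmul_eq_mul, zero_add, nsmul_eq_mul, mul_one] at h
  push_cast at h
  rw [← h]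
  split_ifs with hcn
  · subst hcn
    rw [fwdDiff_iter_eq_factorial]
    rfl
  · rw [fwdDiff_iter_pow_eq_zero_of_lt (lt_of_le_of_ne hc hcn)]
    rfl

/-- The mixed finite difference of order `m` at the origin recovers the coefficient of `x^m` in a
form of degree `|m|`, dehomogenized with respect to `x_0`. -/
lemma sum_piFinset_mul_eval {f : MvPolynomial (Fin (r + 1)) k} {m : Fin (r + 1) →₀ ℕ}
    (hf : f.IsHomogeneous m.degree) (hm : m 0 = 0) :
    ∑ b ∈ Fintype.piFinset (fun i => Finset.range (m i + 1)),
      (∏ i, (-1 : k) ^ (m i - b i) * ((m i).choose (b i) : k)) *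
        eval (Function.update (fun i => (b i : k)) 0 1) f =
      (∏ i, ((m i).factorial : k)) * coeff m f := by
  have key : ∀ c : Fin (r + 1) →₀ ℕ, c.degree = m.degree →
      ∑ b ∈ Fintype.piFinset (fun i => Finset.range (m i + 1)),
        (∏ i, (-1 : k) ^ (m i - b i) * ((m i).choose (b i) : k)) *
          ∏ i, Function.update (fun i => (b i : k)) 0 1 i ^ c i =
      if c = m then ∏ i, ((m i).factorial : k) else 0 := by
    intro c hc
    have h1 : ∀ b ∈ Fintype.piFinset (fun i => Finset.range (m i + 1)),
        (∏ i, (-1 : k) ^ (m i - b i) * ((m i).choose (b i) : k)) *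
          ∏ i, Function.update (fun i => (b i : k)) 0 1 i ^ c i =
        ∏ i, (-1 : k) ^ (m i - b i) * ((m i).choose (b i) : k) *
          (if i = 0 then 1 else (b i : k)) ^ c i := by
      intro b _
      rw [← Finset.prod_mul_distrib]
      refine Finset.prod_congr rfl fun i _ => ?_
      rw [Function.update_apply]
    -- The summand is a product over coordinates, so the sum over the box factors into one-variable
    -- differences.
    rw [Finset.sum_congr rfl h1, ← Finset.prod_univ_sum (fun i => Finset.range (m i + 1))
      (fun i t => (-1 : k) ^ (m i - t) * ((m i).choose t : k) *
          (if i = 0 then 1 else (t : k)) ^ c i)]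
    split_ifs with hcm
    · subst hcm
      refine Finset.prod_congr rfl fun i _ => ?_
      by_cases hi : i = 0
      · subst hi; simp [hm]
      · simp only [if_neg hi]
        rw [sum_range_neg_one_pow_mul_choose_mul_pow k _ _ le_rfl, if_pos rfl]
    -- Exponents of equal total degree that differ must satisfy c_i < m_i somewhere; the difference
    -- of order m_i in that variable kills x_i^{c_i}.
    · obtain ⟨i, hi⟩ : ∃ i, c i < m i := by
        by_contra! h
        refine hcm (Finsupp.ext fun i => ?_)
        rw [Finsupp.degree_eq_sum, Finsupp.degree_eq_sum] at hc
        exact ((Finset.sum_eq_sum_iff_of_le fun i _ => h i).mp hc.symm i (Finset.mem_univ i)).symm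
      refine Finset.prod_eq_zero (Finset.mem_univ i) ?_
      have hi0 : i ≠ 0 := by rintro rfl; omega
      simp only [if_neg hi0]
      rw [sum_range_neg_one_pow_mul_choose_mul_pow k _ _ hi.le, if_neg hi.ne]
  simp_rw [eval_eq', Finset.mul_sum]
  rw [Finset.sum_comm]
  have h2 : ∀ c ∈ f.support, ∑ b ∈ Fintype.piFinset (fun i => Finset.range (m i + 1)),
        (∏ i, (-1 : k) ^ (m i - b i) * ((m i).choose (b i) : k)) *
          (coeff c f * ∏ i, Function.update (fun i => (b i : k)) 0 1 i ^ c i) =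
      if c = m then (∏ i, ((m i).factorial : k)) * coeff m f else 0 := by
    intro c hc
    have hdeg : c.degree = m.degree := by
      by_contra h
      exact mem_support_iff.mp hc (hf.coeff_eq_zero h)
    simp_rw [mul_left_comm _ (coeff c f)]
    rw [← Finset.mul_sum, key c hdeg]
    split_ifs with hcm
    · subst hcm; ring
    · ring
  rw [Finset.sum_congr rfl h2, Finset.sum_ite_eq']
  split_ifs with h
  · rfl
  · rw [notMem_support_iff.mp h, mul_zero]

/-- The form `∏_i ∏_{j < m_i} (x_i - j x_0)`. -/
def newtonForm (k : Type*) [Field k] (m : Fin (r + 1) →₀ ℕ) : MvPolynomial (Fin (r + 1)) k :=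
  ∏ i, ∏ j ∈ Finset.range (m i), (X i - C (j : k) * X 0)

lemma isHomogeneous_newtonForm (m : Fin (r + 1) →₀ ℕ) :
    (newtonForm k m).IsHomogeneous (∑ i, ∑ _j ∈ Finset.range (m i), 1) :=
  IsHomogeneous.prod _ _ _ fun i _ => IsHomogeneous.prod _ _ _ fun _ _ =>
    (isHomogeneous_X k i).sub (isHomogeneous_C_mul_X _ _)

/-- A point b of the lower set `D` cannot dominate m ∉ `D`, so b_i < m_i for some i, and the factor
x_i - b_i x_0 vanishes at b. -/
lemma newtonForm_mem_pointsIdeal (hD : IsLowerSet D) {m : Fin (r + 1) →₀ ℕ} (hm : m ∉ D)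
    (hm0 : m 0 = 0) : newtonForm k m ∈ pointsIdeal (latticePoint k '' D) := by
  rw [mem_pointsIdeal_latticePoint_iff (isHomogeneous_newtonForm m)]
  intro b hb
  obtain ⟨i, hi⟩ : ∃ i, b i < m i := by
    by_contra! h
    exact hm (hD (Finsupp.le_def.mpr h) hb)
  have hi0 : i ≠ 0 := by rintro rfl; omega
  rw [newtonForm, map_prod]
  refine Finset.prod_eq_zero (Finset.mem_univ i) ?_
  rw [map_prod]
  refine Finset.prod_eq_zero (Finset.mem_range.mpr hi) ?_
  simp [Function.update_of_ne hi0]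

/-- The hyperplane section at infinity of the set of lattice points of an order ideal is the
monomial algebra of the order ideal. -/
lemma mem_pointsIdeal_sup_span_X_zero_iff [CharZero k] (hD : IsLowerSet D)
    (hD0 : ∀ m ∈ D, m 0 = 0) (f : MvPolynomial (Fin (r + 1)) k) :
    f ∈ pointsIdeal (latticePoint k '' D) ⊔ Ideal.span {X 0} ↔ ∀ m ∈ D, coeff m f = 0 := by
  constructor
  · intro hf m hm
    obtain ⟨g, hg, h, hh, rfl⟩ := Submodule.mem_sup.mp hf
    obtain ⟨u, rfl⟩ := Ideal.mem_span_singleton.mp hh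
    have h0 : coeff m (X 0 * u) = 0 := by
      rw [coeff_X_mul', if_neg]
      simp [hD0 m hm]
    have h1 := homogeneousComponent_mem_pointsIdeal g hg m.degree
    have h2 := homogeneousComponent_isHomogeneous m.degree g
    rw [mem_pointsIdeal_latticePoint_iff h2] at h1
    have h3 := sum_piFinset_mul_eval h2 (hD0 m hm)
    rw [Finset.sum_eq_zero, coeff_homogeneousComponent, if_pos rfl] at h3
    · rw [coeff_add, h0, add_zero]
      refine (mul_eq_zero.mp h3.symm).resolve_left ?_
      exact Finset.prod_ne_zero_iff.mpr fun i _ => Nat.cast_ne_zero.mpr (Nat.factorial_ne_zero _)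
    · intro b hb
      -- The difference only samples the box below m, which lies in `D`, where the form vanishes.
      have hbm : Finsupp.equivFunOnFinite.symm b ∈ D := by
        refine hD (Finsupp.le_def.mpr fun i => ?_) hm
        exact Nat.lt_succ_iff.mp (Finset.mem_range.mp (Fintype.mem_piFinset.mp hb i))
      have := h1 _ hbm
      simp only [Finsupp.equivFunOnFinite_symm_apply_apply] at this
      rw [this, mul_zero]
  · intro hf
    rw [f.as_sum]
    refine sum_mem fun m hm => ?_
    have hmD : m ∉ D := fun h => mem_support_iff.mp hm (hf m h)
    suffices h : monomial m (1 : k) ∈ pointsIdeal (latticePoint k '' D) ⊔ Ideal.span {X 0} by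
      rw [← mul_one (coeff m f), ← C_mul_monomial]
      exact Ideal.mul_mem_left _ _ h
    have hX : Ideal.Quotient.mk (pointsIdeal (latticePoint k '' D) ⊔ Ideal.span {X 0})
        (X 0 : MvPolynomial (Fin (r + 1)) k) = 0 :=
      Ideal.Quotient.eq_zero_iff_mem.mpr (Ideal.mem_sup_right (Ideal.mem_span_singleton_self _))
    rw [← Ideal.Quotient.eq_zero_iff_mem, monomial_eq, C_1, one_mul,
      Finsupp.prod_fintype _ _ fun i => pow_zero _, map_prod]
    by_cases hm0 : m 0 = 0
    -- Modulo x_0 every factor x_i - j x_0 becomes x_i, so the Newton form becomes x^m.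
    · have h : newtonForm k m ∈ pointsIdeal (latticePoint k '' D) ⊔ Ideal.span {X 0} :=
        Ideal.mem_sup_left (newtonForm_mem_pointsIdeal hD hmD hm0)
      rw [← Ideal.Quotient.eq_zero_iff_mem, newtonForm, map_prod] at h
      rw [← h]
      refine Finset.prod_congr rfl fun i _ => ?_
      simp [map_prod, hX]
    · refine Finset.prod_eq_zero (Finset.mem_univ 0) ?_
      rw [map_pow, hX, zero_pow hm0]

lemma isArtinianReduction_X_zero [CharZero k] (hD : IsLowerSet D) (hfin : D.Finite)
    (hD0 : ∀ m ∈ D, m 0 = 0) : IsArtinianReduction (pointsIdeal (latticePoint k '' D))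
      (pointsIdeal (latticePoint k '' D) ⊔ Ideal.span {X 0}) := by
  refine ⟨X 0, isHomogeneous_X k 0, X_zero_mem_nonZeroDivisors, rfl, ?_⟩
  have := module_finite_of_mem_iff hfin (mem_pointsIdeal_sup_span_X_zero_iff (k := k) hD hD0)
  exact IsArtinianRing.of_finite k _

/-- The origin gives the coefficient of x_0 in a linear form, and then each unit vector gives one of
the others. -/
lemma isNondegenerate_latticePoint (h0 : 0 ∈ D) (h1 : ∀ i, i ≠ 0 → Finsupp.single i 1 ∈ D) :
    IsNondegenerate (latticePoint k '' D) := by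
  intro f hf hhom
  rw [mem_pointsIdeal_latticePoint_iff hhom] at hf
  have hspan : f ∈ Submodule.span k (Set.range (X : Fin (r + 1) → MvPolynomial (Fin (r + 1)) k)) := by
    rw [← homogeneousSubmodule_one_eq_span_X]; exact hhom
  obtain ⟨c, rfl⟩ := (Submodule.mem_span_range_iff_exists_fun k).mp hspan
  have hev : ∀ m ∈ D, ∑ i, c i * Function.update (fun i => (m i : k)) 0 1 i = 0 := by
    intro m hm
    simpa [smul_eq_C_mul] using hf m hm
  have hc0 : c 0 = 0 := by
    have := hev 0 h0
    rw [Finset.sum_eq_single 0] at this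
    · simpa using this
    · intro i _ hi
      simp [Function.update_of_ne hi]
    · simp
  refine Finset.sum_eq_zero fun i _ => ?_
  suffices h : c i = 0 by rw [h, zero_smul]
  by_cases hi : i = 0
  · rw [hi, hc0]
  · have := hev _ (h1 i hi)
    rw [Finset.sum_eq_single i] at this
    · simpa [Function.update_of_ne hi] using this
    · intro j _ hj
      by_cases hj0 : j = 0
      · rw [hj0, hc0, zero_mul]
      · simp [Function.update_of_ne hj0, Finsupp.single_apply, Ne.symm hj]
    · simp

/-- The lattice points of a finite pure order ideal form a level set of points. -/
lemma isLevelSet_latticePoint [CharZero k] (hD : IsLowerSet D) (hfin : D.Finite)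
    (hD0 : ∀ m ∈ D, m 0 = 0) {e : ℕ} (hle : ∀ m ∈ D, m.degree ≤ e) (he : ∃ m ∈ D, m.degree = e)
    (hpure : ∀ m ∈ D, m.degree < e → ∃ j, m + Finsupp.single j 1 ∈ D) :
    IsLevelSet (latticePoint k '' D) := by
  have hred := isArtinianReduction_X_zero (k := k) hD hfin hD0
  have hJ := mem_pointsIdeal_sup_span_X_zero_iff (k := k) hD hD0
  refine ⟨⟨_, hred⟩, _, fun J h => isLevelOfType_of_isArtinianReduction
    homogeneousComponent_mem_pointsIdeal hred h ⟨e, ?_, ?_, rfl, ?_⟩⟩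
  · rw [ne_eq, ← hVector_eq_zero_iff, hVector_eq_ncard_of_mem_iff hfin hJ,
      Set.ncard_eq_zero (hfin.subset fun m hm => hm.1)]
    exact Set.nonempty_iff_ne_empty.mp he
  · intro i hi
    rw [← hVector_eq_zero_iff, hVector_eq_ncard_of_mem_iff hfin hJ,
      Set.ncard_eq_zero (hfin.subset fun m hm => hm.1), Set.eq_empty_iff_forall_notMem]
    rintro m ⟨hm, rfl⟩
    exact absurd (hle m hm) (by omega)
  · intro i hi
    rw [socleVector, socle_inf_gradedPiece_eq_bot hJ, finrank_bot]
    rintro m hm rfl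
    exact hpure m hm (lt_of_le_of_ne (hle m hm) hi)

/-- The `h`-vector counts the elements of the order ideal by degree. -/
lemma hVector_eq_ncard_of_isArtinianReduction [CharZero k] (hD : IsLowerSet D) (hfin : D.Finite)
    (hD0 : ∀ m ∈ D, m 0 = 0) {J : Ideal (MvPolynomial (Fin (r + 1)) k)}
    (hJ : IsArtinianReduction (pointsIdeal (latticePoint k '' D)) J) (i : ℕ) :
    hVector J i = {m : Fin (r + 1) →₀ ℕ | m ∈ D ∧ m.degree = i}.ncard := by
  rw [hVector_eq_of_isArtinianReduction homogeneousComponent_mem_pointsIdeal hJ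
    (isArtinianReduction_X_zero hD hfin hD0),
    hVector_eq_ncard_of_mem_iff hfin (mem_pointsIdeal_sup_span_X_zero_iff hD hD0)]

end PointsIdeal

/-! ### A pure order ideal with a dip in its degree counts -/

section OrderIdeal

variable {s : ℕ}

/-- A pure order ideal in the variables `x_1, …, x_{s+3}`: the monomials of degree at most `12` that
either lie in `x_1, x_2, x_3` and have degree less than `3` in `x_1`, or divide
`x_1 ^ 6 x_2 ^ 3 x_3 ^ 3`, or are powers of one of the remaining variables. -/
def pureOrderIdeal (s : ℕ) : Set (Fin (s + 4) →₀ ℕ) :=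
  {m | m 0 = 0 ∧ m.degree ≤ 12 ∧
    (((∀ j : Fin (s + 4), 3 < j.val → m j = 0) ∧ (m 1 < 3 ∨ m 1 ≤ 6 ∧ m 2 ≤ 3 ∧ m 3 ≤ 3)) ∨
      ∃ j : Fin (s + 4), 3 < j.val ∧ ∀ i, i ≠ j → m i = 0)}

/-- The exponent vector of `x_1 ^ a x_2 ^ b x_3 ^ c`. -/
def tripleExponent (s a b c : ℕ) : Fin (s + 4) →₀ ℕ :=
  Finsupp.single 1 a + Finsupp.single 2 b + Finsupp.single 3 c

lemma val_one_two_three (s : ℕ) : ((1 : Fin (s + 4)) : ℕ) = 1 ∧ ((2 : Fin (s + 4)) : ℕ) = 2 ∧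
    ((3 : Fin (s + 4)) : ℕ) = 3 := by
  exact ⟨Nat.mod_eq_of_lt (by omega : 1 < s + 4), Nat.mod_eq_of_lt (by omega : 2 < s + 4),
    Nat.mod_eq_of_lt (by omega : 3 < s + 4)⟩

lemma tripleExponent_apply (a b c : ℕ) (j : Fin (s + 4)) :
    tripleExponent s a b c j =
      if j.val = 1 then a else if j.val = 2 then b else if j.val = 3 then c else 0 := by
  obtain ⟨h1, h2, h3⟩ := val_one_two_three s
  simp only [tripleExponent, Finsupp.add_apply, Finsupp.single_apply, Fin.ext_iff, h1, h2, h3]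
  split_ifs <;> omega

lemma tripleExponent_coordinates (a b c : ℕ) : tripleExponent s a b c 1 = a ∧
    tripleExponent s a b c 2 = b ∧ tripleExponent s a b c 3 = c := by
  simp only [tripleExponent_apply, val_one_two_three]
  norm_num

lemma degree_tripleExponent (a b c : ℕ) : (tripleExponent s a b c).degree = a + b + c := by
  simp [tripleExponent]

lemma eq_tripleExponent {m : Fin (s + 4) →₀ ℕ} (h0 : m 0 = 0)
    (h : ∀ j : Fin (s + 4), 3 < j.val → m j = 0) : m = tripleExponent s (m 1) (m 2) (m 3) := by
  obtain ⟨h1, h2, h3⟩ := val_one_two_three s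
  ext j
  rw [tripleExponent_apply]
  split_ifs with e1 e2 e3
  · rw [show j = 1 from Fin.ext (by omega)]
  · rw [show j = 2 from Fin.ext (by omega)]
  · rw [show j = 3 from Fin.ext (by omega)]
  · by_cases hj : 3 < j.val
    · exact h j hj
    · rw [show j = 0 from Fin.ext (by rw [Fin.val_zero]; omega), h0]

lemma eq_single_of_forall_ne {m : Fin (s + 4) →₀ ℕ} {j : Fin (s + 4)}
    (h : ∀ i, i ≠ j → m i = 0) : m = Finsupp.single j (m j) := by
  ext i
  rw [Finsupp.single_apply]
  split_ifs with hij
  · rw [hij]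
  · exact h i (Ne.symm hij)

lemma isLowerSet_pureOrderIdeal : IsLowerSet (pureOrderIdeal s) := by
  rintro m n hnm ⟨h0, hdeg, h⟩
  have hle : ∀ i, n i ≤ m i := Finsupp.le_def.mp hnm
  refine ⟨Nat.le_zero.mp (h0 ▸ hle 0), (Finsupp.degree_mono hnm).trans hdeg, ?_⟩
  rcases h with ⟨h, h'⟩ | ⟨j, hj, h⟩
  · refine Or.inl ⟨fun j hj => Nat.le_zero.mp (h j hj ▸ hle j), ?_⟩
    have := hle 1
    have := hle 2
    have := hle 3
    omega
  · exact Or.inr ⟨j, hj, fun i hi => Nat.le_zero.mp (h i hi ▸ hle i)⟩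

lemma finite_pureOrderIdeal : (pureOrderIdeal s).Finite :=
  (Finsupp.finite_of_degree_le 12).subset fun _ hm => hm.2.1

lemma tripleExponent_mem_pureOrderIdeal {a b c : ℕ} (hdeg : a + b + c ≤ 12)
    (h : a < 3 ∨ a ≤ 6 ∧ b ≤ 3 ∧ c ≤ 3) : tripleExponent s a b c ∈ pureOrderIdeal s := by
  refine ⟨by simp [tripleExponent_apply], by rwa [degree_tripleExponent],
    Or.inl ⟨fun j hj => ?_, ?_⟩⟩
  · rw [tripleExponent_apply, if_neg (by omega), if_neg (by omega), if_neg (by omega)]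
  · simpa only [tripleExponent_coordinates] using h

lemma single_mem_pureOrderIdeal {j : Fin (s + 4)} (hj : 3 < j.val) {n : ℕ} (hn : n ≤ 12) :
    Finsupp.single j n ∈ pureOrderIdeal s := by
  have h0 : j ≠ 0 := by rintro rfl; simp at hj
  exact ⟨Finsupp.single_eq_of_ne h0.symm, by simpa, Or.inr ⟨j, hj, fun i hi =>
    Finsupp.single_eq_of_ne hi⟩⟩

lemma mem_pureOrderIdeal_iff {m : Fin (s + 4) →₀ ℕ} : m ∈ pureOrderIdeal s ↔
    (∃ a b c, a + b + c ≤ 12 ∧ (a < 3 ∨ a ≤ 6 ∧ b ≤ 3 ∧ c ≤ 3) ∧ m = tripleExponent s a b c) ∨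
      ∃ j : Fin (s + 4), 3 < j.val ∧ ∃ n ≤ 12, m = Finsupp.single j n := by
  constructor
  · rintro ⟨h0, hdeg, ⟨h, h'⟩ | ⟨j, hj, h⟩⟩
    · have hm := eq_tripleExponent h0 h
      rw [hm, degree_tripleExponent] at hdeg
      exact Or.inl ⟨_, _, _, hdeg, h', hm⟩
    · exact Or.inr ⟨j, hj, m j, (Finsupp.le_degree j m).trans hdeg, eq_single_of_forall_ne h⟩
  · rintro (⟨a, b, c, hdeg, h, rfl⟩ | ⟨j, hj, n, hn, rfl⟩)
    · exact tripleExponent_mem_pureOrderIdeal hdeg h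
    · exact single_mem_pureOrderIdeal hj hn

/-- In the slab x_2 may be raised freely up to degree 12. Outside it the monomial divides x_1^6
x_2^3 x_3^3, whose degree is exactly 12, so in lower degree some exponent can still grow. -/
lemma exists_add_single_mem_pureOrderIdeal {m : Fin (s + 4) →₀ ℕ} (hm : m ∈ pureOrderIdeal s)
    (hdeg : m.degree < 12) : ∃ j, m + Finsupp.single j 1 ∈ pureOrderIdeal s := by
  rcases mem_pureOrderIdeal_iff.mp hm with ⟨a, b, c, -, h, rfl⟩ | ⟨j, hj, n, -, rfl⟩
  · rw [degree_tripleExponent] at hdeg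
    have e1 : tripleExponent s a b c + Finsupp.single 1 1 = tripleExponent s (a + 1) b c := by
      simp only [tripleExponent, Finsupp.single_add]; abel
    have e2 : tripleExponent s a b c + Finsupp.single 2 1 = tripleExponent s a (b + 1) c := by
      simp only [tripleExponent, Finsupp.single_add]; abel
    have e3 : tripleExponent s a b c + Finsupp.single 3 1 = tripleExponent s a b (c + 1) := by
      simp only [tripleExponent, Finsupp.single_add]; abel
    by_cases h1 : a < 3
    · exact ⟨2, e2 ▸ tripleExponent_mem_pureOrderIdeal (by omega) (Or.inl h1)⟩
    · by_cases h2 : a < 6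
      · exact ⟨1, e1 ▸ tripleExponent_mem_pureOrderIdeal (by omega) (by omega)⟩
      · by_cases h3 : b < 3
        · exact ⟨2, e2 ▸ tripleExponent_mem_pureOrderIdeal (by omega) (by omega)⟩
        · exact ⟨3, e3 ▸ tripleExponent_mem_pureOrderIdeal (by omega) (by omega)⟩
  · rw [Finsupp.degree_single] at hdeg
    exact ⟨j, by rw [← Finsupp.single_add]; exact single_mem_pureOrderIdeal hj hdeg⟩

/-- The pairs `(a, b)` such that `x_1 ^ a x_2 ^ b x_3 ^ (i - a - b)` lies in the order ideal. -/
def exponentPairs (i : ℕ) : Finset (ℕ × ℕ) :=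
  (Finset.range 13 ×ˢ Finset.range 13).filter fun p =>
    p.1 + p.2 ≤ i ∧ (p.1 < 3 ∨ p.1 ≤ 6 ∧ p.2 ≤ 3 ∧ i - p.1 - p.2 ≤ 3)

/-- Positive degree is needed: in degree 0 the powers of the extra variables all coincide with 1, so
the union is no longer disjoint. -/
lemma ncard_pureOrderIdeal_degree {i : ℕ} (h0 : 0 < i) (hi : i ≤ 12) :
    {m : Fin (s + 4) →₀ ℕ | m ∈ pureOrderIdeal s ∧ m.degree = i}.ncard =
      (exponentPairs i).card + {j : Fin (s + 4) | 3 < j.val}.ncard := by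
  have hset : {m : Fin (s + 4) →₀ ℕ | m ∈ pureOrderIdeal s ∧ m.degree = i} =
      (fun p : ℕ × ℕ => tripleExponent s p.1 p.2 (i - p.1 - p.2)) '' (exponentPairs i) ∪
        (fun j => Finsupp.single j i) '' {j : Fin (s + 4) | 3 < j.val} := by
    ext m
    constructor
    · rintro ⟨hm, hdeg⟩
      rcases mem_pureOrderIdeal_iff.mp hm with ⟨a, b, c, h, h', rfl⟩ | ⟨j, hj, n, -, rfl⟩
      · rw [degree_tripleExponent] at hdeg
        have hc : i - a - b = c := by omega
        refine Or.inl ⟨(a, b), ?_, by simp only [hc]⟩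
        simp only [exponentPairs, Finset.coe_filter, Finset.mem_product, Finset.mem_range,
          Set.mem_ofPred_eq, hc]
        omega
      · rw [Finsupp.degree_single] at hdeg
        exact Or.inr ⟨j, hj, by simp only [hdeg]⟩
    · rintro (⟨⟨a, b⟩, hp, rfl⟩ | ⟨j, hj, rfl⟩)
      · simp only [exponentPairs, Finset.coe_filter, Finset.mem_product, Finset.mem_range,
          Set.mem_ofPred_eq] at hp
        exact ⟨tripleExponent_mem_pureOrderIdeal (by omega) (by omega),
          by rw [degree_tripleExponent]; dsimp only; omega⟩
      · exact ⟨single_mem_pureOrderIdeal hj hi, Finsupp.degree_single _ _⟩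
  rw [hset, Set.ncard_union_eq, Set.ncard_image_of_injective, Set.ncard_image_of_injective,
    Set.ncard_coe_finset]
  · exact Finsupp.single_left_injective h0.ne'
  · rintro ⟨a, b⟩ ⟨a', b'⟩ h
    have e1 := DFunLike.congr_fun h 1
    have e2 := DFunLike.congr_fun h 2
    simp only [tripleExponent_coordinates] at e1 e2
    rw [e1, e2]
  · rw [Set.disjoint_left]
    rintro _ ⟨p, -, rfl⟩ ⟨j, hj, h⟩
    have hj : 3 < j.val := hj
    have := DFunLike.congr_fun h j
    simp only [Finsupp.single_eq_same, tripleExponent_apply] at this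
    rw [if_neg (by omega), if_neg (by omega), if_neg (by omega)] at this
    omega

end OrderIdeal

/-! ### Failure of unimodality -/

lemma not_isUnimodal_of_lt_of_lt {h : ℕ → ℕ} {a b c : ℕ} (hab : a ≤ b) (hbc : b ≤ c)
    (h1 : h b < h a) (h2 : h b < h c) : ¬ IsUnimodal h := by
  rintro ⟨m, hm, hm'⟩
  rcases le_total b m with hb | hb
  · exact h1.not_ge (hm (hab.trans hb) hb hab)
  · exact h2.not_ge (hm' hb (hb.trans hbc) hbc)

end LevelPoints

end

theorem corollary5p4 {k : Type*} [Field k] [CharZero k] (r : ℕ) (hr : 3 ≤ r) :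
    ∃ X : Set (Projectivization k (Fin (r + 1) → k)),
      X.Finite ∧ LevelPoints.IsNondegenerate X ∧ LevelPoints.IsLevelSet X ∧
      ∀ J : Ideal (MvPolynomial (Fin (r + 1)) k),
        LevelPoints.IsArtinianReduction (LevelPoints.pointsIdeal X) J →
          ¬ LevelPoints.IsUnimodal (LevelPoints.hVector J) := by
  obtain ⟨s, rfl⟩ := Nat.exists_eq_add_of_le' hr
  have hfin := LevelPoints.finite_pureOrderIdeal (s := s)
  have hlow := LevelPoints.isLowerSet_pureOrderIdeal (s := s)
  have hD0 : ∀ m ∈ LevelPoints.pureOrderIdeal s, m 0 = 0 := fun m hm => hm.1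
  refine ⟨LevelPoints.latticePoint k '' LevelPoints.pureOrderIdeal s, hfin.image _,
    ?_, ?_, fun J hJ => ?_⟩
  · refine LevelPoints.isNondegenerate_latticePoint
      ⟨rfl, by simp, Or.inl ⟨fun _ _ => rfl, by simp⟩⟩
      fun i hi => ?_
    by_cases h3 : 3 < i.val
    · exact LevelPoints.single_mem_pureOrderIdeal h3 (by norm_num)
    · refine ⟨Finsupp.single_eq_of_ne hi.symm, by simp, Or.inl ⟨fun j hj =>
        Finsupp.single_eq_of_ne (by rintro rfl; exact h3 hj), Or.inl ?_⟩⟩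
      rw [Finsupp.single_apply]
      split_ifs <;> norm_num
  · refine LevelPoints.isLevelSet_latticePoint hlow hfin hD0 (e := 12) (fun m hm => hm.2.1)
      ⟨LevelPoints.tripleExponent s 0 0 12,
        LevelPoints.tripleExponent_mem_pureOrderIdeal (by norm_num) (by norm_num),
        LevelPoints.degree_tripleExponent _ _ _⟩
      fun m hm h => LevelPoints.exists_add_single_mem_pureOrderIdeal hm h
  -- With s extra variables, the entries in degrees 9, 10, 12 are 27 + 10 + s, 30 + 6 + s, 36 + 1 +
  -- s; the common s cancels, leaving 36 < 37 twice.
  · refine LevelPoints.not_isUnimodal_of_lt_of_lt (a := 9) (b := 10) (c := 12)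
      (by norm_num) (by norm_num) ?_ ?_
    all_goals
      rw [LevelPoints.hVector_eq_ncard_of_isArtinianReduction hlow hfin hD0 hJ,
        LevelPoints.hVector_eq_ncard_of_isArtinianReduction hlow hfin hD0 hJ,
        LevelPoints.ncard_pureOrderIdeal_degree (by norm_num) (by norm_num),
        LevelPoints.ncard_pureOrderIdeal_degree (by norm_num) (by norm_num)]
      refine Nat.add_lt_add_right ?_ _
      decide +kernel
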